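/- Fix $n\ge 0$ and put $m=2n$. Let $e_1,\dots,e_m$ be the standard basis of $\mathbb C^m$ and, for $k\le m$, $\mathbb C^k=\langle e_1,\dots,e_k\rangle\subset\mathbb C^m$. Write $x\in_{\min}\mathbb C^k$ if $x\in\mathbb C^k$ and $x\notin\mathbb C^{k-1}$. For a unit vector $x\in\mathbb C^m$ and $\theta\in\mathbb R$ let $A_{(\theta,x)}=I-(1-e^{i\theta})\,x\,\bar x^{T}$. Let $J_n$ be the block diagonal $2n\times 2n$ matrix with $n$ diagonal blocks $\begin{pmatrix}0&1\\-1&0\end{pmatrix}$, and put $\mathbf j x=J_n\bar x$. *Symbols.* Let $B$ be an $m\times m$ complex matrix. - A strictly increasing sequence $(s_1,\dots,s_k)$, $k\ge 0$, of integers $\ge 1$ is a full increasing Schubert symbol of $B$ if $B=A_{(\theta_1,x_1)}\cdots A_{(\theta_k,x_k)}$ for some unit vectors $x_j\in_{\min}\mathbb C^{s_j}$ and angles $\theta_j\notin 2\pi\mathbb Z$. The corresponding Schubert symbol in the convention for $SU_m$ is obtained from it by discarding the entry $1$ if $s_1=1$. - A strictly increasing sequence $(s_1,\dots,s_k)$,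 $k\ge 0$, of integers $\ge 1$ is a full skew-symmetric Schubert symbol of $B$ if $B$ has an ordered skew-symmetric factorization $$B=A_{(\theta_1,x_1)}\cdots A_{(\theta_k,x_k)}\cdot A_{(\theta_k,\mathbf j x_k)}\cdots A_{(\theta_1,\mathbf j x_1)}$$ with unit vectors $x_j\in_{\min}\mathbb C^{2s_j-1}$ and $\theta_j\notin 2\pi\mathbb Z$. - A strictly increasing sequence $(s_1,\dots,s_k)$, $k\ge 0$, with all $s_j>1$ is a skew-symmetric Schubert symbol of $B$ in the convention for $SU_{2n}/Sp_n$ if $$B=A_{(-2\pi T,e_1)}\,A_{(2\pi t_1,x_1)}\cdots A_{(2\pi t_k,x_k)}\cdot A_{(2\pi t_k,\mathbf j x_k)}\cdots A_{(2\pi t_1,\mathbf j x_1)}\,A_{(-2\pi T,\mathbf j e_1)},\qquad T=\sum_{j} t_j,$$ for some $0<t_j<1$ and unit vectors $x_j\in_{\min}\mathbb C^{2s_j-1}$ whose $(2s_j-1)$-st coordinate is real and positive. (For $n=0$, where $B$ is the empty matrix, only the empty sequence occurs.) **Statement.** Let $B=A J_n^{-1}$ with $A\in SU_{2n}$ and $A^T=-A$.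 Then there is a sequence $1\le m_1<m_2<\cdots<m_r\le n$ (with $r\ge 0$) such that 1. $(2m_1-1,2m_1,\dots,2m_r-1,2m_r)$ is a full increasing Schubert symbol of $B$, and it is the only one; 2. $(m_1,\dots,m_r)$ is a full skew-symmetric Schubert symbol of $B$, and it is the only one; that is, $B$ has an ordered skew-symmetric factorization, and every one of them has the symbol $(m_1,\dots,m_r)$; 3. the Schubert symbol of $B$ in the convention for $SU_{2n}$ is unique; it is $(2m_1-1,2m_1,\dots,2m_r-1,2m_r)$ if $r=0$ or $m_1>1$, and $(2,2m_2-1,2m_2,\dots,2m_r-1,2m_r)$ if $m_1=1$; 4. if moreover $B=C J_n C^T J_n^{*}$ for some $C\in SU_{2n}$, then $B$ has exactly one skew-symmetric Schubert symbol in the convention for $SU_{2n}/Sp_n$; it is $(m_1,\dots,m_r)$ if $r=0$ or $m_1>1$, and $(m_2,\dots,m_r)$ if $m_1=1$. -/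

import Mathlib

open Matrix

namespace SkewSchubert

/-- The pseudo-rotation `A_(θ, x) = I - (1 - e^{iθ}) x x̄ᵀ` of `ℂ^N`, for `x` a unit vector. -/
noncomputable def pseudoRotation {N : ℕ} (θ : ℝ) (x : Fin N → ℂ) : Matrix (Fin N) (Fin N) ℂ :=
  1 - (1 - Complex.exp (θ * Complex.I)) • vecMulVec x (star x)

/-- `x` has Hermitian norm `1`. -/
def IsUnitVector {N : ℕ} (x : Fin N → ℂ) : Prop := ∑ i, ‖x i‖ ^ 2 = 1

/-- `x` minimally belongs to `ℂ^k`, that is `x_k ≠ 0` and `x_{k+1} = ⋯ = x_N = 0`.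
The number `k` is counted from `1`, so that the `k`-th coordinate has the index `k - 1` in `Fin N`. -/
def MinMem {N : ℕ} (x : Fin N → ℂ) (k : ℕ) : Prop :=
  (∃ i : Fin N, (i : ℕ) + 1 = k ∧ x i ≠ 0) ∧ ∀ i : Fin N, k ≤ (i : ℕ) → x i = 0

/-- The `k`-th coordinate (counted from `1`) of `x` is a positive real number. -/
def PosCoord {N : ℕ} (x : Fin N → ℂ) (k : ℕ) : Prop :=
  ∃ i : Fin N, (i : ℕ) + 1 = k ∧ 0 < (x i).re ∧ (x i).im = 0

/-- `s = (m_1 < ⋯ < m_k)` is the symbol of an increasing ordered factorization of `B`: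
`B = A_(θ_1, x_1) ⋯ A_(θ_k, x_k)` with unit vectors `x_j` minimally belonging to `ℂ^{m_j}` and
angles `θ_j` that are not multiples of `2π`. Here `m_1 = 1` is allowed. -/
def HasFullSymbol {N : ℕ} (B : Matrix (Fin N) (Fin N) ℂ) (s : List ℕ) : Prop :=
  s.Pairwise (· < ·) ∧
    ∃ (θ : Fin s.length → ℝ) (x : Fin s.length → Fin N → ℂ),
      (∀ j, IsUnitVector (x j) ∧ MinMem (x j) (s.get j) ∧ ∀ z : ℤ, θ j ≠ z * (2 * Real.pi)) ∧
      B = (List.ofFn fun j => pseudoRotation (θ j) (x j)).prod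

/-- The Schubert symbol in the convention for the special unitary group: an initial entry `1` of
the symbol is discarded (its angle is determined by the others through `det B = 1`). -/
def HasReducedSymbol {N : ℕ} (B : Matrix (Fin N) (Fin N) ℂ) (s : List ℕ) : Prop :=
  (HasFullSymbol B s ∧ 1 ∉ s) ∨ HasFullSymbol B (1 :: s)

/-- `J_n`: block diagonal with `n` blocks `!![0, 1; -1, 0]`. -/
def Jmat (n : ℕ) : Matrix (Fin (2 * n)) (Fin (2 * n)) ℂ :=
  Matrix.of fun i j =>
    if (i : ℕ) % 2 = 0 ∧ (j : ℕ) = i + 1 then 1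
    else if (j : ℕ) % 2 = 0 ∧ (i : ℕ) = j + 1 then -1
    else 0

/-- The quaternionic multiplication `𝐣 x = J_n x̄` on `ℂ^{2n}`. -/
def quatJ {n : ℕ} (x : Fin (2 * n) → ℂ) : Fin (2 * n) → ℂ := Jmat n *ᵥ star x

/-- The special unitary skew-symmetric `2n × 2n` matrices. -/
def compactModelSk (n : ℕ) : Set (Matrix (Fin (2 * n)) (Fin (2 * n)) ℂ) :=
  {A | A ∈ Matrix.specialUnitaryGroup (Fin (2 * n)) ℂ ∧ Aᵀ = -A}

/-- The products `A J_n⁻¹` with `A` special unitary and skew-symmetric. -/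
def cartanModelSk (n : ℕ) : Set (Matrix (Fin (2 * n)) (Fin (2 * n)) ℂ) :=
  {B | ∃ A ∈ compactModelSk n, B = A * (Jmat n)⁻¹}

/-- The image of `SU_{2n} / Sp_n` in `SU_{2n}`, that is the matrices `C J_n Cᵀ J_n^*`
with `C` in `SU_{2n}`. It is contained in `cartanModelSk n`, and consists of those elements `B` of
it for which `B J_n` has Pfaffian `1` (and not `-1`). -/
def cartanOrbitSk (n : ℕ) : Set (Matrix (Fin (2 * n)) (Fin (2 * n)) ℂ) :=
  {B | ∃ C ∈ Matrix.specialUnitaryGroup (Fin (2 * n)) ℂ, B = C * Jmat n * Cᵀ * (Jmat n)ᴴ}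

/-- `s = (m_1 < ⋯ < m_r)` is the symbol of an ordered skew-symmetric factorization of `B`:
`B = A_(θ_1, x_1) ⋯ A_(θ_r, x_r) A_(θ_r, 𝐣 x_r) ⋯ A_(θ_1, 𝐣 x_1)` with unit vectors `x_j`
minimally belonging to `ℂ^{2 m_j - 1}` (so that the quaternionic line of `x_j` minimally belongs to
`ℂ^{2 m_j}`) and angles `θ_j` that are not multiples of `2π`. Here `m_1 = 1` is allowed;
`m_1 = 0` is not, because nothing minimally belongs to `ℂ^0`. -/
def HasFullSkewSymbol {n : ℕ} (B : Matrix (Fin (2 * n)) (Fin (2 * n)) ℂ) (s : List ℕ) : Prop :=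
  s.Pairwise (· < ·) ∧
    ∃ (θ : Fin s.length → ℝ) (x : Fin s.length → Fin (2 * n) → ℂ),
      (∀ j, IsUnitVector (x j) ∧ MinMem (x j) (2 * s.get j - 1) ∧
        ∀ z : ℤ, θ j ≠ z * (2 * Real.pi)) ∧
      B = (List.ofFn fun j => pseudoRotation (θ j) (x j)).prod *
        (List.ofFn fun j => pseudoRotation (θ j) (quatJ (x j))).reverse.prod

/-- The first standard basis vector. -/
def e₁ (N : ℕ) : Fin N → ℂ := fun i => if (i : ℕ) = 0 then 1 else 0

/-- The skew-symmetric Schubert symbol in the convention for `SU_{2n} / Sp_n`: `B` lies in the open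
skew-symmetric Schubert cell of `s = (m_1 < ⋯ < m_k)` with `1 < m_1`. With `T = t_1 + ⋯ + t_k`,
`B` is the product of the `A_(2πt_j, x_j)` in increasing and the `A_(2πt_j, 𝐣 x_j)` in decreasing
order of `j`, enclosed by the correcting factors `A_(-2πT, e_1)` and `A_(-2πT, 𝐣 e_1)`,
where `0 < t_j < 1` and the `x_j` are unit vectors minimally belonging to `ℂ^{2 m_j - 1}`
with positive last nonzero coordinate. -/
def HasReducedSkewSymbol {n : ℕ} (B : Matrix (Fin (2 * n)) (Fin (2 * n)) ℂ) (s : List ℕ) : Prop :=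
  s.Pairwise (· < ·) ∧ (∀ a ∈ s, 1 < a) ∧
    ∃ (t : Fin s.length → ℝ) (x : Fin s.length → Fin (2 * n) → ℂ),
      (∀ j, 0 < t j ∧ t j < 1 ∧ IsUnitVector (x j) ∧ MinMem (x j) (2 * s.get j - 1) ∧
        PosCoord (x j) (2 * s.get j - 1)) ∧
      B = pseudoRotation (-(2 * Real.pi * ∑ j, t j)) (e₁ (2 * n)) *
        (List.ofFn fun j => pseudoRotation (2 * Real.pi * t j) (x j)).prod *
        (List.ofFn fun j => pseudoRotation (2 * Real.pi * t j) (quatJ (x j))).reverse.prod *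
        pseudoRotation (-(2 * Real.pi * ∑ j, t j)) (quatJ (e₁ (2 * n)))

/-- `(m_1, …, m_r) ↦ (2m_1 - 1, 2m_1, …, 2m_r - 1, 2m_r)`. -/
def doubled (m : List ℕ) : List ℕ := m.flatMap fun a => [2 * a - 1, 2 * a]

end SkewSchubert

/-!
Let `W` be the range of `1 - B`. For unitary `B` it is the orthogonal complement of the vectors fixed
by `B` (`mem_movedSpace_iff`). If `B` is a product, in any order, of nontrivial pseudo-rotations about
vectors with distinct leading positions, then these vectors are independent, a vector fixed by `B` is
orthogonal to all of them, and hence they span `W`; so the set of leading positions of `W` is the set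
of leading positions of these vectors (`positions_movedSpace_rotProd`). As `W` depends on `B` only,
this is the uniqueness of the full symbols. In a skew-symmetric factorization the vectors `x_j`, `𝐣 x_j`
have the leading positions `2 m_j - 1`, `2 m_j`, so its symbol determines the full symbol by doubling
and is determined by it.

A factorization is found by splitting off its first factor. Let `x` be a unit vector of `W` with the
lowest leading position, say `x = v - B v`. As `B` preserves the norm of `v`, there is a
pseudo-rotation `A` about `x` with `A v = B v`. Then `A⁻¹ B` fixes `v` besides the fixed vectors of
`B`, and `v` is not orthogonal to `x`; so its moved space is a subspace of `W` without `x`, and it has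
lost the lowest leading position (`positions_descent`).

In the Cartan model `B J_n` is skew-symmetric. This makes `W` closed under `𝐣`, so that its leading
positions come in pairs `2a - 1, 2a` (`two_mul_mem_positions_iff`), and it makes `v` orthogonal to
`𝐣 x` in the argument above (`star_quatJ_dotProduct_mulVec`). Hence `A_(-θ, x) B A_(-θ, 𝐣 x)`, which is
again in the model, fixes `v`, and has lost the lowest pair of positions (`exists_rotProd_skew`).

For the convention of `SU_{2n} / Sp_n`, the factors can be given positive last coordinates and angles
in `(0, 2π)`, and a first factor about `ℂ^1` is one about `e₁`. It remains to see that the angles of a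
full skew-symmetric factorization add up to a multiple of `2π`. Its left half `P` satisfies
`P J_n Pᵀ = B J_n = C J_n Cᵀ`, so `C⁻¹ P` is symplectic and has determinant `1`, whence `det P = 1`
(`exp_sum_eq_one_of_mem_cartanOrbitSk`).
-/

open Matrix

namespace SkewSchubert

variable {N n : ℕ}

/-! ### Pseudo-rotations -/

theorem isUnitVector_iff {x : Fin N → ℂ} : IsUnitVector x ↔ star x ⬝ᵥ x = 1 := by
  have h : star x ⬝ᵥ x = ((∑ i, ‖x i‖ ^ 2 : ℝ) : ℂ) := by
    simp [dotProduct, Complex.conj_mul']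
  rw [h, IsUnitVector]
  norm_cast

theorem exp_mul_I_eq_one_iff (θ : ℝ) :
    Complex.exp (θ * Complex.I) = 1 ↔ ∃ z : ℤ, θ = z * (2 * Real.pi) := by
  rw [Complex.exp_eq_one_iff]
  refine exists_congr fun z => ?_
  rw [← mul_assoc, mul_left_inj' Complex.I_ne_zero]
  norm_cast

theorem pseudoRotation_mulVec (θ : ℝ) (x v : Fin N → ℂ) :
    pseudoRotation θ x *ᵥ v = v - ((1 - Complex.exp (θ * Complex.I)) * (star x ⬝ᵥ v)) • x := by
  ext i
  simp [pseudoRotation, sub_mulVec, smul_mulVec, vecMulVec_mulVec]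
  ring

theorem pseudoRotation_congr {θ φ : ℝ} (x : Fin N → ℂ)
    (h : Complex.exp (θ * Complex.I) = Complex.exp (φ * Complex.I)) :
    pseudoRotation θ x = pseudoRotation φ x := by
  simp [pseudoRotation, h]

theorem pseudoRotation_eq_one {θ : ℝ} (x : Fin N → ℂ) (h : Complex.exp (θ * Complex.I) = 1) :
    pseudoRotation θ x = 1 := by
  simp [pseudoRotation, h]

theorem pseudoRotation_mul {x : Fin N → ℂ} (hx : IsUnitVector x) (θ φ : ℝ) :
    pseudoRotation θ x * pseudoRotation φ x = pseudoRotation (θ + φ) x := by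
  rw [isUnitVector_iff] at hx
  simp only [pseudoRotation, sub_mul, mul_sub, one_mul, mul_one, smul_mul_assoc, mul_smul_comm,
    vecMulVec_mul_vecMulVec, hx, one_smul, Complex.ofReal_add, add_mul, Complex.exp_add]
  module

theorem pseudoRotation_neg_mul {x : Fin N → ℂ} (hx : IsUnitVector x) (θ : ℝ) :
    pseudoRotation (-θ) x * pseudoRotation θ x = 1 := by
  rw [pseudoRotation_mul hx]
  exact pseudoRotation_eq_one x (by simp)

theorem pseudoRotation_mul_neg {x : Fin N → ℂ} (hx : IsUnitVector x) (θ : ℝ) :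
    pseudoRotation θ x * pseudoRotation (-θ) x = 1 := by
  rw [pseudoRotation_mul hx]
  exact pseudoRotation_eq_one x (by simp)

theorem pseudoRotation_conjTranspose (θ : ℝ) (x : Fin N → ℂ) :
    (pseudoRotation θ x)ᴴ = pseudoRotation (-θ) x := by
  have h : star (Complex.exp (θ * Complex.I)) = Complex.exp (((-θ : ℝ) : ℂ) * Complex.I) := by
    rw [Complex.star_def, ← Complex.exp_conj]
    simp
  simp [pseudoRotation, conjTranspose_vecMulVec, h]

theorem pseudoRotation_mem_unitary {x : Fin N → ℂ} (hx : IsUnitVector x) (θ : ℝ) :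
    pseudoRotation θ x ∈ unitaryGroup (Fin N) ℂ := by
  rw [mem_unitaryGroup_iff, star_eq_conjTranspose, pseudoRotation_conjTranspose,
    pseudoRotation_mul_neg hx]

theorem pseudoRotation_smul (θ : ℝ) (x : Fin N → ℂ) {u : ℂ} (hu : ‖u‖ = 1) :
    pseudoRotation θ (u • x) = pseudoRotation θ x := by
  have h : u * star u = 1 := by
    rw [Complex.star_def, Complex.mul_conj', hu]; simp
  have : vecMulVec (u • x) (star (u • x)) = vecMulVec x (star x) := by
    rw [star_smul, smul_vecMulVec, vecMulVec_smul, smul_smul, h, one_smul]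
  rw [pseudoRotation, this, pseudoRotation]

theorem det_pseudoRotation {x : Fin N → ℂ} (hx : IsUnitVector x) (θ : ℝ) :
    (pseudoRotation θ x).det = Complex.exp (θ * Complex.I) := by
  rw [isUnitVector_iff] at hx
  have : pseudoRotation θ x
      = 1 + vecMulVec (-(1 - Complex.exp (θ * Complex.I)) • x) (star x) := by
    rw [pseudoRotation, smul_vecMulVec, neg_smul, sub_eq_add_neg]
  rw [this, vecMulVec_eq Unit, det_one_add_replicateCol_mul_replicateRow]
  simp [dotProduct_smul, hx]

/-! ### The quaternionic structure -/

theorem Jmat_transpose (n : ℕ) : (Jmat n)ᵀ = -Jmat n := by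
  ext i j
  rw [transpose_apply, neg_apply]
  simp only [Jmat, of_apply]
  split_ifs <;> first | omega | simp

theorem Jmat_map_star (n : ℕ) : (Jmat n).map star = Jmat n := by
  ext i j
  simp only [Jmat, map_apply, of_apply]
  split_ifs <;> simp

theorem Jmat_conjTranspose (n : ℕ) : (Jmat n)ᴴ = -Jmat n := by
  rw [← Jmat_transpose, conjTranspose, transpose_map, Jmat_map_star]

theorem Jmat_mulVec_even (w : Fin (2 * n) → ℂ) (i j : Fin (2 * n)) (hi : (i : ℕ) % 2 = 0)
    (hj : (j : ℕ) = i + 1) : (Jmat n *ᵥ w) i = w j := by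
  rw [mulVec, dotProduct, Finset.sum_eq_single j]
  · simp [Jmat, hi, hj]
  · intro k _ hk
    have : (k : ℕ) ≠ i + 1 := fun h => hk (Fin.ext (by omega))
    simp only [Jmat, of_apply]
    rw [if_neg (by omega), if_neg (by omega), zero_mul]
  · simp

theorem Jmat_mulVec_odd (w : Fin (2 * n) → ℂ) (i j : Fin (2 * n)) (hi : (i : ℕ) % 2 = 0)
    (hj : (j : ℕ) = i + 1) : (Jmat n *ᵥ w) j = -w i := by
  rw [mulVec, dotProduct, Finset.sum_eq_single i]
  · simp only [Jmat, of_apply]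
    rw [if_neg (by omega), if_pos (by omega)]
    ring
  · intro k _ hk
    have : (k : ℕ) ≠ i := fun h => hk (Fin.ext (by omega))
    simp only [Jmat, of_apply]
    rw [if_neg (by omega), if_neg (by omega), zero_mul]
  · simp

/-- Every index belongs to a `2 × 2` block of `J_n`, with the even index `i` and the odd index
`j = i + 1`. -/
theorem exists_even_odd (k : Fin (2 * n)) : ∃ i j : Fin (2 * n), (i : ℕ) % 2 = 0 ∧
    (j : ℕ) = i + 1 ∧ (k = i ∨ k = j) := by
  have := k.isLt
  rcases Nat.mod_two_eq_zero_or_one k with h | h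
  · exact ⟨k, ⟨k + 1, by omega⟩, h, rfl, Or.inl rfl⟩
  · exact ⟨⟨k - 1, by omega⟩, k, by simp; omega, by simp; omega, Or.inr rfl⟩

theorem Jmat_mul_Jmat (n : ℕ) : Jmat n * Jmat n = -1 := by
  refine ext_of_mulVec_single fun k => ?_
  generalize (Pi.single k (1 : ℂ) : Fin (2 * n) → ℂ) = w
  rw [← mulVec_mulVec, neg_mulVec, one_mulVec]
  ext k
  obtain ⟨i, j, hi, hj, rfl | rfl⟩ := exists_even_odd k
  · rw [Jmat_mulVec_even _ _ j hi hj, Jmat_mulVec_odd _ _ _ hi hj]; rfl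
  · rw [Jmat_mulVec_odd _ i _ hi hj, Jmat_mulVec_even _ _ _ hi hj]; rfl

theorem Jmat_inv (n : ℕ) : (Jmat n)⁻¹ = -Jmat n :=
  inv_eq_right_inv (by rw [mul_neg, Jmat_mul_Jmat, neg_neg])

theorem quatJ_even (x : Fin (2 * n) → ℂ) (i j : Fin (2 * n)) (hi : (i : ℕ) % 2 = 0)
    (hj : (j : ℕ) = i + 1) : quatJ x i = star (x j) :=
  Jmat_mulVec_even _ i j hi hj

theorem quatJ_odd (x : Fin (2 * n) → ℂ) (i j : Fin (2 * n)) (hi : (i : ℕ) % 2 = 0)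
    (hj : (j : ℕ) = i + 1) : quatJ x j = -star (x i) :=
  Jmat_mulVec_odd _ i j hi hj

theorem quatJ_smul (c : ℂ) (x : Fin (2 * n) → ℂ) : quatJ (c • x) = star c • quatJ x := by
  rw [quatJ, star_smul, mulVec_smul, quatJ]

theorem star_quatJ (x : Fin (2 * n) → ℂ) : star (quatJ x) = Jmat n *ᵥ x := by
  rw [quatJ, star_mulVec, star_star, Jmat_conjTranspose, ← Jmat_transpose, vecMul_transpose]

theorem quatJ_quatJ (x : Fin (2 * n) → ℂ) : quatJ (quatJ x) = -x := by
  rw [quatJ, star_quatJ, mulVec_mulVec, Jmat_mul_Jmat, neg_mulVec, one_mulVec]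

theorem star_quatJ_dotProduct (x y : Fin (2 * n) → ℂ) :
    star (quatJ x) ⬝ᵥ y = -(star (quatJ y) ⬝ᵥ x) := by
  rw [star_quatJ, star_quatJ, ← vecMul_transpose, ← dotProduct_mulVec, Jmat_transpose, neg_mulVec,
    dotProduct_neg, dotProduct_comm]

theorem star_quatJ_dotProduct_self (x : Fin (2 * n) → ℂ) : star (quatJ x) ⬝ᵥ x = 0 := by
  have h := star_quatJ_dotProduct x x
  exact self_eq_neg.mp h

theorem star_quatJ_dotProduct_quatJ (x y : Fin (2 * n) → ℂ) :
    star (quatJ x) ⬝ᵥ quatJ y = star (star x ⬝ᵥ y) := by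
  rw [star_quatJ_dotProduct, quatJ_quatJ, star_neg, neg_dotProduct, neg_neg, star_dotProduct,
    dotProduct_comm]

theorem isUnitVector_quatJ {x : Fin (2 * n) → ℂ} (hx : IsUnitVector x) :
    IsUnitVector (quatJ x) := by
  rw [isUnitVector_iff] at *
  rw [star_quatJ_dotProduct_quatJ, hx, star_one]

theorem Jmat_mul_pseudoRotation_transpose (θ : ℝ) (x : Fin (2 * n) → ℂ) :
    Jmat n * (pseudoRotation θ x)ᵀ = pseudoRotation θ (quatJ x) * Jmat n := by
  have h : star (quatJ x) ᵥ* Jmat n = x := by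
    rw [star_quatJ, ← mulVec_transpose, mulVec_mulVec, Jmat_transpose, neg_mul, Jmat_mul_Jmat]
    simp
  simp only [pseudoRotation, transpose_sub, transpose_one, transpose_smul, transpose_vecMulVec,
    mul_sub, sub_mul, mul_one, one_mul, mul_smul_comm, smul_mul_assoc, mul_vecMulVec,
    vecMulVec_mul, h]
  rfl

theorem Jmat_mul_pseudoRotation_quatJ_transpose (θ : ℝ) (x : Fin (2 * n) → ℂ) :
    Jmat n * (pseudoRotation θ (quatJ x))ᵀ = pseudoRotation θ x * Jmat n := by
  rw [Jmat_mul_pseudoRotation_transpose, quatJ_quatJ, ← pseudoRotation_smul θ x (u := -1) (by simp)]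
  simp

/-! ### Leading positions -/

theorem MinMem.ne_zero {w : Fin N → ℂ} {a : ℕ} (h : MinMem w a) : w ≠ 0 := by
  rintro rfl
  obtain ⟨⟨i, -, hi⟩, -⟩ := h
  exact hi rfl

theorem MinMem.pos {w : Fin N → ℂ} {a : ℕ} (h : MinMem w a) : 1 ≤ a := by
  obtain ⟨⟨i, rfl, -⟩, -⟩ := h
  omega

theorem MinMem.le {w : Fin N → ℂ} {a : ℕ} (h : MinMem w a) : a ≤ N := by
  obtain ⟨⟨i, rfl, -⟩, -⟩ := h
  omega

theorem MinMem.le_of_minMem {w : Fin N → ℂ} {a b : ℕ} (h : MinMem w a) (h' : MinMem w b) :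
    a ≤ b := by
  obtain ⟨⟨i, rfl, hi⟩, -⟩ := h
  by_contra hb
  exact hi (h'.2 i (by omega))

theorem MinMem.unique {w : Fin N → ℂ} {a b : ℕ} (h : MinMem w a) (h' : MinMem w b) : a = b :=
  le_antisymm (h.le_of_minMem h') (h'.le_of_minMem h)

/-- The leading position of a nonzero vector lies below any index from which on it vanishes. -/
theorem exists_minMem_of_le {w : Fin N → ℂ} (hw : w ≠ 0) {b : ℕ}
    (hb : ∀ i : Fin N, b ≤ (i : ℕ) → w i = 0) : ∃ a ≤ b, MinMem w a := by
  obtain ⟨i₀, hi₀⟩ := Function.ne_iff.mp hw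
  obtain ⟨i, hi, hmax⟩ := (Finset.univ.filter fun i => w i ≠ 0).exists_max_image id
    ⟨i₀, by simpa using hi₀⟩
  rw [Finset.mem_filter] at hi
  refine ⟨i + 1, ?_, ⟨i, rfl, hi.2⟩, fun j hj => ?_⟩
  · by_contra h
    exact hi.2 (hb i (by omega))
  · by_contra h
    have : j ≤ i := hmax j (by simpa using h)
    rw [Fin.le_def] at this
    omega

theorem exists_minMem {w : Fin N → ℂ} (hw : w ≠ 0) : ∃ a, MinMem w a := by
  obtain ⟨a, -, h⟩ := exists_minMem_of_le hw (b := N) fun i hi => absurd i.isLt (by omega)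
  exact ⟨a, h⟩

theorem MinMem.smul {w : Fin N → ℂ} {a : ℕ} (h : MinMem w a) {c : ℂ} (hc : c ≠ 0) :
    MinMem (c • w) a := by
  obtain ⟨⟨i, hi, hw⟩, h⟩ := h
  exact ⟨⟨i, hi, by simp [hc, hw]⟩, fun j hj => by simp [h j hj]⟩

theorem MinMem.add_of_lt {x y : Fin N → ℂ} {a b : ℕ} (hx : MinMem x a) (hy : MinMem y b)
    (hab : b < a) : MinMem (x + y) a := by
  obtain ⟨⟨i, hi, hxi⟩, hx⟩ := hx
  refine ⟨⟨i, hi, ?_⟩, fun j hj => ?_⟩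
  · rw [Pi.add_apply, hy.2 i (by omega), add_zero]
    exact hxi
  · rw [Pi.add_apply, hx j hj, hy.2 j (by omega), add_zero]

/-- Subtracting a multiple clears the leading coordinate. -/
theorem MinMem.exists_sub_smul {x y : Fin N → ℂ} {a : ℕ} (hx : MinMem x a) (hy : MinMem y a) :
    ∃ c : ℂ, y = c • x ∨ ∃ b < a, MinMem (y - c • x) b := by
  obtain ⟨⟨i, hi, hxi⟩, hx⟩ := hx
  refine ⟨y i / x i, ?_⟩
  by_cases h : y = (y i / x i) • x
  · exact Or.inl h
  · obtain ⟨b, hb, hm⟩ := exists_minMem_of_le (sub_ne_zero.mpr h) (b := i) fun j hj => by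
      rcases hj.eq_or_lt with hj | hj
      · rw [← Fin.ext hj]
        simp [hxi]
      · simp [hx j (by omega), hy.2 j (by omega)]
    exact Or.inr ⟨b, by omega, hm⟩

theorem mem_span_cons_iff {y w : Fin N → ℂ} {Y : List (Fin N → ℂ)} :
    w ∈ Submodule.span ℂ {v | v ∈ y :: Y} ↔
      ∃ c : ℂ, ∃ w' ∈ Submodule.span ℂ {v | v ∈ Y}, w = c • y + w' := by
  rw [← Submodule.mem_span_insert]
  simp only [List.mem_cons]
  rfl

/-- Every nonzero vector in the span of vectors with distinct leading positions has one of these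
positions. -/
theorem exists_minMem_of_mem_span {Y : List (Fin N → ℂ)} {p : List ℕ}
    (h : List.Forall₂ MinMem Y p) (hp : p.Nodup) {w : Fin N → ℂ}
    (hw : w ∈ Submodule.span ℂ {v | v ∈ Y}) : w = 0 ∨ ∃ a ∈ p, MinMem w a := by
  induction h generalizing w with
  | nil => left; simpa using hw
  | @cons y a Y p hy _ ih =>
    rw [List.nodup_cons] at hp
    obtain ⟨c, w', hw', rfl⟩ := mem_span_cons_iff.mp hw
    by_cases hc : c = 0
    · rw [hc, zero_smul, zero_add]
      exact (ih hp.2 hw').imp_right fun ⟨b, hb, h⟩ => ⟨b, List.mem_cons_of_mem _ hb, h⟩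
    · right
      have hcy := hy.smul hc
      rcases ih hp.2 hw' with rfl | ⟨b, hb, h⟩
      · exact ⟨a, List.mem_cons_self, by rwa [add_zero]⟩
      · rcases lt_trichotomy a b with hab | rfl | hab
        · exact ⟨b, List.mem_cons_of_mem _ hb, by rw [add_comm]; exact h.add_of_lt hcy hab⟩
        · exact absurd hb hp.1
        · exact ⟨a, List.mem_cons_self, hcy.add_of_lt h hab⟩

/-- The set of leading positions of the nonzero vectors of a subspace (its Schubert symbol), counted
from `1`. -/
def positions (W : Submodule ℂ (Fin N → ℂ)) : Set ℕ := {a | ∃ w ∈ W, MinMem w a}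

theorem positions_finite (W : Submodule ℂ (Fin N → ℂ)) : (positions W).Finite :=
  (Set.finite_Iic N).subset fun _ ⟨_, _, h⟩ => h.le

theorem positions_mono {W W' : Submodule ℂ (Fin N → ℂ)} (h : W ≤ W') :
    positions W ⊆ positions W' :=
  fun _ ⟨w, hw, ha⟩ => ⟨w, h hw, ha⟩

theorem eq_bot_of_positions_eq_empty {W : Submodule ℂ (Fin N → ℂ)} (h : positions W = ∅) :
    W = ⊥ := by
  refine (Submodule.eq_bot_iff W).mpr fun w hw => ?_
  by_contra hne
  obtain ⟨a, ha⟩ := exists_minMem hne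
  have : a ∈ positions W := ⟨w, hw, ha⟩
  simp [h] at this

/-- In a subspace `W`, the vectors at the lowest leading position of `W` are unique up to scaling,
so a subspace of `W` that misses one of them misses that position. -/
theorem notMem_positions_of_isLeast {W W' : Submodule ℂ (Fin N → ℂ)} (hW : W' ≤ W) {a : ℕ}
    (ha : IsLeast (positions W) a) {x : Fin N → ℂ} (hx : x ∈ W) (hxa : MinMem x a)
    (hx' : x ∉ W') : a ∉ positions W' := by
  rintro ⟨y, hy, hya⟩
  obtain ⟨c, h | ⟨b, hb, h⟩⟩ := hya.exists_sub_smul hxa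
  · exact hx' (h ▸ W'.smul_mem c hy)
  · exact absurd (ha.2 ⟨_, W.sub_mem hx (W.smul_mem c (hW hy)), h⟩) (by omega)

/-! ### The moved space -/

/-- The range of `1 - B`. For unitary `B` it is the orthogonal complement of the fixed vectors. -/
def movedSpace (B : Matrix (Fin N) (Fin N) ℂ) : Submodule ℂ (Fin N → ℂ) :=
  LinearMap.range (1 - B).mulVecLin

theorem mem_movedSpace {B : Matrix (Fin N) (Fin N) ℂ} {w : Fin N → ℂ} :
    w ∈ movedSpace B ↔ ∃ v, v - B *ᵥ v = w := by
  simp [movedSpace]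

theorem dotProduct_mulVec_of_fixed {B : Matrix (Fin N) (Fin N) ℂ}
    (hB : B ∈ unitaryGroup (Fin N) ℂ) {v : Fin N → ℂ} (hv : B *ᵥ v = v) (u : Fin N → ℂ) :
    star v ⬝ᵥ (B *ᵥ u) = star v ⬝ᵥ u := by
  have h : Bᴴ *ᵥ v = v := by
    conv_lhs => rw [← hv]
    rw [mulVec_mulVec, ← star_eq_conjTranspose, mem_unitaryGroup_iff'.mp hB, one_mulVec]
  rw [dotProduct_mulVec, ← conjTranspose_conjTranspose B, ← star_mulVec, h]

open scoped ComplexOrder in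
theorem mem_movedSpace_iff {B : Matrix (Fin N) (Fin N) ℂ} (hB : B ∈ unitaryGroup (Fin N) ℂ)
    {w : Fin N → ℂ} : w ∈ movedSpace B ↔ ∀ v, B *ᵥ v = v → star v ⬝ᵥ w = 0 := by
  have key : ∀ w ∈ movedSpace B, ∀ v, B *ᵥ v = v → star v ⬝ᵥ w = 0 := by
    intro w hw v hv
    obtain ⟨u, rfl⟩ := mem_movedSpace.mp hw
    rw [dotProduct_sub, dotProduct_mulVec_of_fixed hB hv, sub_self]
  refine ⟨key w, fun hw => ?_⟩
  have hker : ∀ v, v ∈ LinearMap.ker (1 - B).mulVecLin ↔ B *ᵥ v = v := fun v => by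
    rw [LinearMap.mem_ker, mulVecLin_apply, sub_mulVec, one_mulVec, sub_eq_zero, eq_comm]
  -- The range and the kernel of `1 - B` are orthogonal, so by dimension they span everything.
  have htop : movedSpace B ⊔ LinearMap.ker (1 - B).mulVecLin = ⊤ := by
    refine Submodule.eq_top_of_disjoint _ _
      (LinearMap.finrank_range_add_finrank_ker (1 - B).mulVecLin).ge ?_
    rw [Submodule.disjoint_def]
    exact fun v hv hv' => dotProduct_star_self_eq_zero.mp
      (key v hv v ((hker v).mp hv'))
  obtain ⟨r, hr, k, hk, rfl⟩ := Submodule.mem_sup.mp (htop ▸ Submodule.mem_top : w ∈ _)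
  rw [hker] at hk
  have h := hw k hk
  rw [dotProduct_add, key r hr k hk, zero_add, dotProduct_star_self_eq_zero] at h
  rwa [h, add_zero]

theorem movedSpace_mono {B B' : Matrix (Fin N) (Fin N) ℂ} (hB : B ∈ unitaryGroup (Fin N) ℂ)
    (hB' : B' ∈ unitaryGroup (Fin N) ℂ) (h : ∀ v, B *ᵥ v = v → B' *ᵥ v = v) :
    movedSpace B' ≤ movedSpace B := fun w hw => by
  rw [mem_movedSpace_iff hB'] at hw
  rw [mem_movedSpace_iff hB]
  exact fun v hv => hw v (h v hv)

theorem eq_one_of_movedSpace_eq_bot {B : Matrix (Fin N) (Fin N) ℂ} (h : movedSpace B = ⊥) :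
    B = 1 := by
  refine ext_of_mulVec_single fun i => ?_
  have : _ ∈ movedSpace B := mem_movedSpace.mpr ⟨Pi.single i 1, rfl⟩
  rw [h, Submodule.mem_bot, sub_eq_zero] at this
  rw [one_mulVec, ← this]

/-! ### Products of pseudo-rotations -/

/-- The factor `A_(θ, x)`, encoded as `(θ, x)`, may stand at the entry `a` of a symbol. The condition
on the angle says that it is not a multiple of `2π`. -/
def Admissible (q : ℝ × (Fin N → ℂ)) (a : ℕ) : Prop :=
  IsUnitVector q.2 ∧ MinMem q.2 a ∧ Complex.exp (q.1 * Complex.I) ≠ 1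

/-- The product of the pseudo-rotations encoded by a list of pairs `(θ, x)`. -/
noncomputable def rotProd (L : List (ℝ × (Fin N → ℂ))) : Matrix (Fin N) (Fin N) ℂ :=
  (L.map fun q => pseudoRotation q.1 q.2).prod

@[simp]
theorem rotProd_nil : rotProd ([] : List (ℝ × (Fin N → ℂ))) = 1 := rfl

@[simp]
theorem rotProd_cons (q : ℝ × (Fin N → ℂ)) (L : List (ℝ × (Fin N → ℂ))) :
    rotProd (q :: L) = pseudoRotation q.1 q.2 * rotProd L := by
  simp [rotProd]

@[simp]
theorem rotProd_append (L L' : List (ℝ × (Fin N → ℂ))) :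
    rotProd (L ++ L') = rotProd L * rotProd L' := by
  simp [rotProd]

theorem rotProd_mem_unitary {L : List (ℝ × (Fin N → ℂ))} (h : ∀ q ∈ L, IsUnitVector q.2) :
    rotProd L ∈ unitaryGroup (Fin N) ℂ := by
  refine Submonoid.list_prod_mem _ fun A hA => ?_
  obtain ⟨q, hq, rfl⟩ := List.mem_map.mp hA
  exact pseudoRotation_mem_unitary (h q hq) q.1

theorem sub_rotProd_mulVec_mem_span (L : List (ℝ × (Fin N → ℂ))) (v : Fin N → ℂ) :
    v - rotProd L *ᵥ v ∈ Submodule.span ℂ {y | y ∈ L.map Prod.snd} := by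
  induction L with
  | nil => simp
  | cons q L ih =>
    rw [List.map_cons, mem_span_cons_iff]
    refine ⟨(1 - Complex.exp (q.1 * Complex.I)) * (star q.2 ⬝ᵥ rotProd L *ᵥ v), _, ih, ?_⟩
    rw [rotProd_cons, ← mulVec_mulVec, pseudoRotation_mulVec]
    abel

theorem forall₂_minMem {L : List (ℝ × (Fin N → ℂ))} {p : List ℕ}
    (h : List.Forall₂ Admissible L p) : List.Forall₂ MinMem (L.map Prod.snd) p := by
  rw [List.forall₂_map_left_iff]
  exact h.imp fun _ _ h => h.2.1

/-- A vector fixed by a product of nontrivial pseudo-rotations about independent vectors is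
orthogonal to all of them. -/
theorem dotProduct_eq_zero_of_rotProd_mulVec {L : List (ℝ × (Fin N → ℂ))} {p : List ℕ}
    (h : List.Forall₂ Admissible L p) (hp : p.Nodup) {v : Fin N → ℂ} (hv : rotProd L *ᵥ v = v) :
    ∀ q ∈ L, star q.2 ⬝ᵥ v = 0 := by
  induction h with
  | nil => simp
  | @cons q a L p hq hL ih =>
    rw [List.nodup_cons] at hp
    rw [rotProd_cons, ← mulVec_mulVec, pseudoRotation_mulVec] at hv
    set c := (1 - Complex.exp (q.1 * Complex.I)) * (star q.2 ⬝ᵥ rotProd L *ᵥ v) with hc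
    have hmem : c • q.2 ∈ Submodule.span ℂ {y | y ∈ L.map Prod.snd} := by
      have := Submodule.neg_mem _ (sub_rotProd_mulVec_mem_span L v)
      rwa [neg_sub, show rotProd L *ᵥ v - v = c • q.2 by rw [sub_eq_iff_eq_add'] at hv ⊢
                                                         rw [hv, add_comm]] at this
    have hc0 : c = 0 := by
      by_contra hne
      have hm := hq.2.1.smul hne
      rcases exists_minMem_of_mem_span (forall₂_minMem hL) hp.2 hmem with h0 | ⟨b, hb, h⟩
      · exact hm.ne_zero h0
      · exact hp.1 (hm.unique h ▸ hb)
    rw [hc0, zero_smul, sub_zero] at hv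
    rw [hv] at hc
    intro q' hq'
    rcases List.mem_cons.mp hq' with rfl | hq'
    · exact (mul_eq_zero.mp (hc.symm.trans hc0)).resolve_left (sub_ne_zero.mpr hq.2.2.symm)
    · exact ih hp.2 hv q' hq'

theorem exists_of_mem_right {α β : Type*} {R : α → β → Prop} {l : List α} {l' : List β}
    (h : List.Forall₂ R l l') {b : β} (hb : b ∈ l') : ∃ a ∈ l, R a b := by
  induction h with
  | nil => simp at hb
  | cons h _ ih =>
    rcases List.mem_cons.mp hb with rfl | hb
    · exact ⟨_, List.mem_cons_self, h⟩
    · obtain ⟨a, ha, h⟩ := ih hb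
      exact ⟨a, List.mem_cons_of_mem _ ha, h⟩

theorem isUnitVector_of_forall₂ {L : List (ℝ × (Fin N → ℂ))} {p : List ℕ}
    (h : List.Forall₂ Admissible L p) : ∀ q ∈ L, IsUnitVector q.2 := fun _ hq =>
  let ⟨_, _, ha⟩ := exists_of_mem_right h.flip hq
  ha.1

/-- The symbol of a factorization is read off the moved space of the product. -/
theorem positions_movedSpace_rotProd {L : List (ℝ × (Fin N → ℂ))} {p : List ℕ}
    (h : List.Forall₂ Admissible L p) (hp : p.Nodup) :
    positions (movedSpace (rotProd L)) = {a | a ∈ p} := by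
  ext a
  constructor
  · rintro ⟨w, hw, hwa⟩
    obtain ⟨v, rfl⟩ := mem_movedSpace.mp hw
    rcases exists_minMem_of_mem_span (forall₂_minMem h) hp (sub_rotProd_mulVec_mem_span L v) with
      h0 | ⟨b, hb, hwb⟩
    · exact absurd h0 hwa.ne_zero
    · exact hwa.unique hwb ▸ hb
  · intro ha
    obtain ⟨q, hq, hqa⟩ := exists_of_mem_right h ha
    refine ⟨q.2, (mem_movedSpace_iff (rotProd_mem_unitary (isUnitVector_of_forall₂ h))).mpr
      fun v hv => ?_, hqa.2.1⟩
    have := congrArg star (dotProduct_eq_zero_of_rotProd_mulVec h hp hv q hq)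
    rwa [star_dotProduct, star_star, star_zero] at this

/-! ### Existence of increasing factorizations -/

theorem exists_isUnitVector {W : Submodule ℂ (Fin N → ℂ)} {a : ℕ} (ha : a ∈ positions W) :
    ∃ x ∈ W, IsUnitVector x ∧ MinMem x a := by
  obtain ⟨w, hw, hwa⟩ := ha
  set r := ∑ i, ‖w i‖ ^ 2 with hr
  have hr0 : 0 < r := by
    obtain ⟨i, hi⟩ := Function.ne_iff.mp hwa.ne_zero
    exact Finset.sum_pos' (fun j _ => by positivity)
      ⟨i, Finset.mem_univ i, pow_pos (norm_pos_iff.mpr hi) 2⟩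
  have hc : (((Real.sqrt r)⁻¹ : ℝ) : ℂ) ≠ 0 :=
    Complex.ofReal_ne_zero.mpr (inv_ne_zero (Real.sqrt_pos.mpr hr0).ne')
  refine ⟨(((Real.sqrt r)⁻¹ : ℝ) : ℂ) • w, W.smul_mem _ hw, ?_, hwa.smul hc⟩
  simp only [IsUnitVector, Pi.smul_apply, norm_smul, mul_pow, ← Finset.mul_sum, ← hr,
    Complex.norm_real, Real.norm_eq_abs, sq_abs, inv_pow, Real.sq_sqrt hr0.le]
  exact inv_mul_cancel₀ hr0.ne'

/-- A unitary matrix that moves `v` by a unit vector `x` agrees on `v` with some pseudo-rotation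
about `x`, and `v` is not orthogonal to `x`. -/
theorem exists_pseudoRotation_mulVec_eq {B : Matrix (Fin N) (Fin N) ℂ}
    (hB : B ∈ unitaryGroup (Fin N) ℂ) {x v : Fin N → ℂ} (hx : IsUnitVector x)
    (hv : v - B *ᵥ v = x) :
    ∃ θ : ℝ, Complex.exp (θ * Complex.I) ≠ 1 ∧ pseudoRotation θ x *ᵥ v = B *ᵥ v ∧
      star x ⬝ᵥ v ≠ 0 := by
  rw [isUnitVector_iff] at hx
  have hBv : B *ᵥ v = v - x := by rw [← hv]; abel
  set z := star x ⬝ᵥ v with hz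
  have hz' : star v ⬝ᵥ x = star z := by rw [hz, star_dotProduct]
  -- `B` preserves the norm of `v`.
  have h1 : z + star z = 1 := by
    have h : star (B *ᵥ v) ⬝ᵥ (B *ᵥ v) = star v ⬝ᵥ v := by
      rw [star_mulVec, ← dotProduct_mulVec, mulVec_mulVec, ← star_eq_conjTranspose,
        mem_unitaryGroup_iff'.mp hB, one_mulVec]
    rw [hBv, star_sub, sub_dotProduct, dotProduct_sub, dotProduct_sub, hx, hz', ← hz] at h
    linear_combination -h
  have hz0 : z ≠ 0 := by
    intro h
    simp [h] at h1
  have hsz0 : star z ≠ 0 := star_ne_zero.mpr hz0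
  have hu : ‖1 - z⁻¹‖ = 1 := by
    have : (1 - z⁻¹) * star (1 - z⁻¹) = 1 := by
      rw [star_sub, star_one, star_inv₀]
      field_simp
      linear_combination -h1
    rw [Complex.star_def, Complex.mul_conj'] at this
    exact (pow_eq_one_iff_of_nonneg (norm_nonneg _) two_ne_zero).mp (by exact_mod_cast this)
  obtain ⟨θ, hθ⟩ := (Complex.norm_eq_one_iff _).mp hu
  refine ⟨θ, ?_, ?_, hz0⟩
  · rw [hθ]
    simpa using hz0
  · rw [pseudoRotation_mulVec, hθ, ← hz, hBv, sub_sub_cancel, inv_mul_cancel₀ hz0, one_smul]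

theorem star_dotProduct_eq_zero_of_fixed {B : Matrix (Fin N) (Fin N) ℂ}
    (hB : B ∈ unitaryGroup (Fin N) ℂ) {x v : Fin N → ℂ} (hx : x ∈ movedSpace B)
    (hv : B *ᵥ v = v) : star x ⬝ᵥ v = 0 := by
  have := congrArg star ((mem_movedSpace_iff hB).mp hx v hv)
  rwa [star_dotProduct, star_star, star_zero] at this

/-- If `B'` fixes more than `B`, namely a vector not orthogonal to the lowest vector `x` of the moved
space of `B`, then the symbol of `B'` lies in that of `B` and misses the position of `x`. -/
theorem positions_descent {B B' : Matrix (Fin N) (Fin N) ℂ} (hB : B ∈ unitaryGroup (Fin N) ℂ)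
    (hB' : B' ∈ unitaryGroup (Fin N) ℂ) (h : ∀ v, B *ᵥ v = v → B' *ᵥ v = v) {a : ℕ}
    (ha : IsLeast (positions (movedSpace B)) a) {x v : Fin N → ℂ} (hx : x ∈ movedSpace B)
    (hxa : MinMem x a) (hv : B' *ᵥ v = v) (hxv : star x ⬝ᵥ v ≠ 0) :
    positions (movedSpace B') ⊆ positions (movedSpace B) ∧ a ∉ positions (movedSpace B') ∧
      (positions (movedSpace B')).ncard < (positions (movedSpace B)).ncard := by
  have hle := movedSpace_mono hB hB' h
  have hx' : x ∉ movedSpace B' := fun hmem =>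
    hxv (star_dotProduct_eq_zero_of_fixed hB' hmem hv)
  have hna := notMem_positions_of_isLeast hle ha hx hxa hx'
  have hsub := positions_mono hle
  exact ⟨hsub, hna, Set.ncard_lt_ncard (hsub.ssubset_of_ne fun heq => hna (heq ▸ ha.1))
    (positions_finite _)⟩

theorem exists_isLeast_positions {W : Submodule ℂ (Fin N → ℂ)} (h : (positions W).Nonempty) :
    ∃ a, IsLeast (positions W) a :=
  ⟨sInf (positions W), Nat.sInf_mem h, fun _ hb => Nat.sInf_le hb⟩

theorem pseudoRotation_mulVec_of_orthogonal (θ : ℝ) {x v : Fin N → ℂ} (h : star x ⬝ᵥ v = 0) :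
    pseudoRotation θ x *ᵥ v = v := by
  rw [pseudoRotation_mulVec, h, mul_zero, zero_smul, sub_zero]

theorem exists_rotProd {B : Matrix (Fin N) (Fin N) ℂ} (hB : B ∈ unitaryGroup (Fin N) ℂ) :
    ∃ s : List ℕ, s.Pairwise (· < ·) ∧ ∃ L, List.Forall₂ Admissible L s ∧ B = rotProd L := by
  induction hk : (positions (movedSpace B)).ncard using Nat.strong_induction_on generalizing B with
  | _ k ih =>
    subst hk
    rcases (positions (movedSpace B)).eq_empty_or_nonempty with he | hne
    · exact ⟨[], List.Pairwise.nil, [], List.Forall₂.nil,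
        eq_one_of_movedSpace_eq_bot (eq_bot_of_positions_eq_empty he)⟩
    obtain ⟨a, ha⟩ := exists_isLeast_positions hne
    obtain ⟨x, hxW, hx, hxa⟩ := exists_isUnitVector ha.1
    obtain ⟨v, hv⟩ := mem_movedSpace.mp hxW
    obtain ⟨θ, hθ, hθv, hxv⟩ := exists_pseudoRotation_mulVec_eq hB hx hv
    have hB' : pseudoRotation (-θ) x * B ∈ unitaryGroup (Fin N) ℂ :=
      mul_mem (pseudoRotation_mem_unitary hx _) hB
    obtain ⟨hsub, hna, hlt⟩ := positions_descent hB hB' (fun w hw => by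
      rw [← mulVec_mulVec, hw, pseudoRotation_mulVec_of_orthogonal _
        (star_dotProduct_eq_zero_of_fixed hB hxW hw)]) ha hxW hxa
      (by rw [← mulVec_mulVec, ← hθv, mulVec_mulVec, pseudoRotation_neg_mul hx, one_mulVec]) hxv
    obtain ⟨s, hs, L, hL, hprod⟩ := ih _ hlt hB' rfl
    refine ⟨a :: s, List.pairwise_cons.mpr ⟨fun b hb => ?_, hs⟩, (θ, x) :: L,
      List.Forall₂.cons ⟨hx, hxa, hθ⟩ hL, ?_⟩
    · have hb' : b ∈ positions (movedSpace (pseudoRotation (-θ) x * B)) := by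
        rw [hprod, positions_movedSpace_rotProd hL hs.nodup]
        exact hb
      exact lt_of_le_of_ne (ha.2 (hsub hb')) fun h => hna (h ▸ hb')
    · rw [rotProd_cons, ← hprod, ← Matrix.mul_assoc, pseudoRotation_mul_neg hx, Matrix.one_mul]

/-! ### Moved spaces closed under the quaternionic structure -/

theorem quatJ_eq_zero_of_le {x : Fin (2 * n) → ℂ} {a : ℕ}
    (h : ∀ i : Fin (2 * n), 2 * a ≤ (i : ℕ) → x i = 0) (k : Fin (2 * n)) (hk : 2 * a ≤ (k : ℕ)) :
    quatJ x k = 0 := by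
  obtain ⟨i, j, hi, hj, rfl | rfl⟩ := exists_even_odd k
  · rw [quatJ_even x _ j hi hj, h j (by omega), star_zero]
  · rw [quatJ_odd x i _ hi hj, h i (by omega), star_zero, neg_zero]

theorem MinMem.quatJ {x : Fin (2 * n) → ℂ} {a : ℕ} (h : MinMem x (2 * a - 1)) :
    MinMem (quatJ x) (2 * a) := by
  have := h.pos
  obtain ⟨⟨i, hi, hxi⟩, h⟩ := h
  refine ⟨⟨⟨i + 1, by omega⟩, by simp; omega, ?_⟩,
    quatJ_eq_zero_of_le fun k hk => h k (by omega)⟩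
  rw [quatJ_odd x i ⟨i + 1, by omega⟩ (by omega) rfl]
  simpa using hxi

/-- In a subspace closed under `𝐣`, the leading positions come in pairs `2a - 1, 2a`: the span of `x`
and `𝐣 x` contains a vector whose `2a`-th coordinate vanishes. -/
theorem two_mul_mem_positions_iff {W : Submodule ℂ (Fin (2 * n) → ℂ)}
    (hW : ∀ w ∈ W, quatJ w ∈ W) {a : ℕ} :
    2 * a ∈ positions W ↔ 2 * a - 1 ∈ positions W := by
  constructor
  · rintro ⟨x, hx, hxa⟩
    have := hxa.pos
    obtain ⟨⟨j, hj, hxj⟩, h⟩ := hxa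
    have hi : ((⟨j - 1, by omega⟩ : Fin (2 * n)) : ℕ) % 2 = 0 := by simp; omega
    have hj' : (j : ℕ) = ((⟨j - 1, by omega⟩ : Fin (2 * n)) : ℕ) + 1 := by simp; omega
    set i : Fin (2 * n) := ⟨j - 1, by omega⟩
    refine ⟨star (x i) • x + x j • SkewSchubert.quatJ x,
      W.add_mem (W.smul_mem _ hx) (W.smul_mem _ (hW x hx)), ⟨i, by omega, ?_⟩, fun k hk => ?_⟩
    · have : star (x i) * x i + x j * star (x j) = ((‖x i‖ ^ 2 + ‖x j‖ ^ 2 : ℝ) : ℂ) := by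
        rw [Complex.star_def, Complex.mul_conj', Complex.conj_mul']
        push_cast
        rfl
      simp only [Pi.add_apply, Pi.smul_apply, smul_eq_mul, quatJ_even x i j hi hj', this]
      have : 0 < ‖x j‖ := norm_pos_iff.mpr hxj
      exact Complex.ofReal_ne_zero.mpr (by positivity)
    · rcases (show (j : ℕ) ≤ k by omega).eq_or_lt with hk | hk
      · rw [← Fin.ext hk]
        simp only [Pi.add_apply, Pi.smul_apply, smul_eq_mul, quatJ_odd x i j hi hj']
        ring
      · simp [h k (by omega), quatJ_eq_zero_of_le h k (by omega)]
  · rintro ⟨x, hx, hxa⟩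
    exact ⟨_, hW x hx, hxa.quatJ⟩

theorem mulVec_quatJ_of_fixed {B : Matrix (Fin (2 * n)) (Fin (2 * n)) ℂ}
    (hB : B ∈ unitaryGroup (Fin (2 * n)) ℂ) (hJ : Jmat n * Bᵀ = B * Jmat n)
    {v : Fin (2 * n) → ℂ} (hv : B *ᵥ v = v) : B *ᵥ quatJ v = quatJ v := by
  have h : Bᴴ *ᵥ v = v := by
    conv_lhs => rw [← hv]
    rw [mulVec_mulVec, ← star_eq_conjTranspose, mem_unitaryGroup_iff'.mp hB, one_mulVec]
  rw [quatJ, mulVec_mulVec, ← hJ, ← mulVec_mulVec, mulVec_transpose,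
    ← conjTranspose_conjTranspose B, ← star_mulVec, h]

theorem quatJ_mem_movedSpace {B : Matrix (Fin (2 * n)) (Fin (2 * n)) ℂ}
    (hB : B ∈ unitaryGroup (Fin (2 * n)) ℂ) (hJ : Jmat n * Bᵀ = B * Jmat n)
    {w : Fin (2 * n) → ℂ} (hw : w ∈ movedSpace B) : quatJ w ∈ movedSpace B := by
  rw [mem_movedSpace_iff hB]
  intro v hv
  have h := (mem_movedSpace_iff hB).mp hw _ (mulVec_quatJ_of_fixed hB hJ hv)
  rw [star_quatJ_dotProduct, neg_eq_zero] at h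
  rw [← star_star (star v ⬝ᵥ quatJ w), ← star_dotProduct, h, star_zero]

/-! ### Skew-symmetric factorizations -/

/-- The matrix `B J_n`, for `B = A J_n⁻¹` in the Cartan model, is skew-symmetric. -/
theorem mem_cartanModelSk {B : Matrix (Fin (2 * n)) (Fin (2 * n)) ℂ} (hB : B ∈ cartanModelSk n) :
    B ∈ unitaryGroup (Fin (2 * n)) ℂ ∧ Jmat n * Bᵀ = B * Jmat n := by
  obtain ⟨A, ⟨hA, hskew⟩, rfl⟩ := hB
  rw [Jmat_inv]
  refine ⟨mul_mem (mem_specialUnitaryGroup_iff.mp hA).1 ?_, ?_⟩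
  · rw [mem_unitaryGroup_iff, star_eq_conjTranspose, conjTranspose_neg, Jmat_conjTranspose, neg_neg,
      neg_mul, Jmat_mul_Jmat, neg_neg]
  · rw [transpose_mul, transpose_neg, Jmat_transpose, neg_neg, hskew, ← Matrix.mul_assoc,
      Jmat_mul_Jmat, Matrix.mul_assoc A, neg_mul (Jmat n), Jmat_mul_Jmat]
    simp

/-- If `B J_n` is skew-symmetric then `v` and `B v` are orthogonal with respect to the associated
symplectic form. -/
theorem star_quatJ_dotProduct_mulVec {B : Matrix (Fin (2 * n)) (Fin (2 * n)) ℂ}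
    (hJ : Jmat n * Bᵀ = B * Jmat n) (v : Fin (2 * n) → ℂ) :
    star (quatJ v) ⬝ᵥ (B *ᵥ v) = 0 := by
  have hskew : (Jmat n * B)ᵀ = -(Jmat n * B) := by
    have h : Jmat n * (Jmat n * Bᵀ) * Jmat n = Jmat n * (B * Jmat n) * Jmat n := by rw [hJ]
    rw [← Matrix.mul_assoc, Jmat_mul_Jmat, Matrix.mul_assoc, Matrix.mul_assoc, Matrix.mul_assoc,
      Jmat_mul_Jmat] at h
    rw [transpose_mul, Jmat_transpose]
    simpa using h
  have h : v ⬝ᵥ ((Jmat n * B) *ᵥ v) = 0 := by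
    refine self_eq_neg.mp ?_
    conv_lhs => rw [dotProduct_mulVec, ← mulVec_transpose, hskew, neg_mulVec, neg_dotProduct,
      dotProduct_comm]
  rw [star_quatJ, ← vecMul_transpose, ← dotProduct_mulVec, Jmat_transpose, neg_mulVec,
    mulVec_mulVec, dotProduct_neg, h, neg_zero]

/-- The list of the factors `A_(θ, 𝐣 x)` corresponding to factors `A_(θ, x)`. -/
noncomputable def quatJList (L : List (ℝ × (Fin (2 * n) → ℂ))) : List (ℝ × (Fin (2 * n) → ℂ)) :=
  L.map fun q => (q.1, quatJ q.2)

theorem rotProd_quatJList_cons_reverse (q : ℝ × (Fin (2 * n) → ℂ))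
    (L : List (ℝ × (Fin (2 * n) → ℂ))) :
    rotProd (quatJList (q :: L)).reverse
      = rotProd (quatJList L).reverse * pseudoRotation q.1 (quatJ q.2) := by
  simp [quatJList]

theorem mem_doubled {b : ℕ} {m : List ℕ} : b ∈ doubled m ↔ ∃ a ∈ m, b = 2 * a - 1 ∨ b = 2 * a := by
  simp [doubled]

theorem pairwise_doubled {m : List ℕ} (h : m.Pairwise (· < ·)) (h1 : ∀ a ∈ m, 1 ≤ a) :
    (doubled m).Pairwise (· < ·) := by
  induction m with
  | nil => exact List.Pairwise.nil
  | cons a m ih =>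
    rw [List.pairwise_cons] at h
    have ha := h1 a List.mem_cons_self
    have hrest := ih h.2 fun b hb => h1 b (List.mem_cons_of_mem _ hb)
    have hlt : ∀ c ∈ doubled m, 2 * a < c := fun c hc => by
      obtain ⟨b, hb, hc⟩ := mem_doubled.mp hc
      have := h.1 b hb
      omega
    change List.Pairwise _ ((2 * a - 1) :: (2 * a) :: doubled m)
    refine List.pairwise_cons.mpr ⟨fun c hc => ?_, List.pairwise_cons.mpr ⟨hlt, hrest⟩⟩
    rcases List.mem_cons.mp hc with rfl | hc
    · omega
    · have := hlt c hc
      omega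

theorem forall₂_quatJList {L : List (ℝ × (Fin (2 * n) → ℂ))} {s : List ℕ}
    (h : List.Forall₂ Admissible L (s.map fun a => 2 * a - 1)) :
    List.Forall₂ Admissible (quatJList L) (s.map fun a => 2 * a) := by
  rw [quatJList, List.forall₂_map_left_iff, List.forall₂_map_right_iff]
  rw [List.forall₂_map_right_iff] at h
  exact h.imp fun _ _ h => ⟨isUnitVector_quatJ h.1, h.2.1.quatJ, h.2.2⟩

theorem one_le_of_forall₂ {L : List (ℝ × (Fin N → ℂ))} {s : List ℕ}
    (h : List.Forall₂ Admissible L (s.map fun a => 2 * a - 1)) : ∀ a ∈ s, 1 ≤ a := fun a ha => by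
  obtain ⟨q, -, hq⟩ := exists_of_mem_right h (List.mem_map_of_mem ha)
  have := hq.2.1.pos
  omega

/-- The full symbol of a product in skew-symmetric order is the doubled skew-symmetric symbol. -/
theorem positions_movedSpace_skew {L : List (ℝ × (Fin (2 * n) → ℂ))} {s : List ℕ}
    (h : List.Forall₂ Admissible L (s.map fun a => 2 * a - 1)) (hs : s.Pairwise (· < ·)) :
    positions (movedSpace (rotProd L * rotProd (quatJList L).reverse)) = {b | b ∈ doubled s} := by
  have h1 := one_le_of_forall₂ h
  rw [← rotProd_append, positions_movedSpace_rotProd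
    (List.rel_append h (List.rel_reverse (forall₂_quatJList h)))]
  · ext b
    simp only [mem_doubled, List.mem_append, List.mem_map, List.mem_reverse, Set.mem_ofPred_eq]
    grind
  · have hmap : (s.map fun a => 2 * a - 1).Nodup :=
      List.Nodup.map_on (fun a ha b hb hab => by have := h1 a ha; have := h1 b hb; omega) hs.nodup
    have hmap' : (s.map fun a => 2 * a).Nodup :=
      hs.nodup.map fun a b hab => by simpa using hab
    refine List.Nodup.append hmap (List.nodup_reverse.mpr hmap') fun b hb hb' => ?_
    obtain ⟨a, ha, rfl⟩ := List.mem_map.mp hb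
    obtain ⟨c, hc, hac⟩ := List.mem_map.mp (List.mem_reverse.mp hb')
    have := h1 a ha
    omega

theorem exists_rotProd_skew {B : Matrix (Fin (2 * n)) (Fin (2 * n)) ℂ}
    (hB : B ∈ unitaryGroup (Fin (2 * n)) ℂ) (hJ : Jmat n * Bᵀ = B * Jmat n) :
    ∃ s : List ℕ, s.Pairwise (· < ·) ∧ ∃ L, List.Forall₂ Admissible L (s.map fun a => 2 * a - 1) ∧
      B = rotProd L * rotProd (quatJList L).reverse := by
  induction hk : (positions (movedSpace B)).ncard using Nat.strong_induction_on generalizing B with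
  | _ k ih =>
    subst hk
    rcases (positions (movedSpace B)).eq_empty_or_nonempty with he | hne
    · refine ⟨[], List.Pairwise.nil, [], List.Forall₂.nil, ?_⟩
      rw [eq_one_of_movedSpace_eq_bot (eq_bot_of_positions_eq_empty he)]
      simp [quatJList]
    have hstable := fun w hw => quatJ_mem_movedSpace hB hJ (w := w) hw
    obtain ⟨l, hl⟩ := exists_isLeast_positions hne
    -- The lowest position is odd, because the positions come in pairs.
    obtain ⟨a, rfl⟩ : ∃ a, l = 2 * a - 1 := by
      rcases Nat.even_or_odd' l with ⟨c, rfl | rfl⟩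
      · have := hl.2 ((two_mul_mem_positions_iff hstable).mp hl.1)
        exact ⟨c, by omega⟩
      · exact ⟨c + 1, by omega⟩
    obtain ⟨x, hxW, hx, hxa⟩ := exists_isUnitVector hl.1
    obtain ⟨v, hv⟩ := mem_movedSpace.mp hxW
    obtain ⟨θ, hθ, hθv, hxv⟩ := exists_pseudoRotation_mulVec_eq hB hx hv
    have hjx := isUnitVector_quatJ hx
    set B' := pseudoRotation (-θ) x * B * pseudoRotation (-θ) (quatJ x) with hB'def
    have hB' : B' ∈ unitaryGroup (Fin (2 * n)) ℂ :=
      mul_mem (mul_mem (pseudoRotation_mem_unitary hx _) hB) (pseudoRotation_mem_unitary hjx _)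
    have hJ' : Jmat n * B'ᵀ = B' * Jmat n := by
      rw [hB'def, transpose_mul, transpose_mul, ← Matrix.mul_assoc,
        Jmat_mul_pseudoRotation_quatJ_transpose, Matrix.mul_assoc, ← Matrix.mul_assoc (Jmat n), hJ,
        Matrix.mul_assoc B, Jmat_mul_pseudoRotation_transpose]
      simp only [Matrix.mul_assoc]
    have hfix : ∀ w, B *ᵥ w = w → B' *ᵥ w = w := fun w hw => by
      rw [hB'def, ← mulVec_mulVec, pseudoRotation_mulVec_of_orthogonal _
        (star_dotProduct_eq_zero_of_fixed hB (hstable x hxW) hw), ← mulVec_mulVec, hw,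
        pseudoRotation_mulVec_of_orthogonal _ (star_dotProduct_eq_zero_of_fixed hB hxW hw)]
    have hjxv : star (quatJ x) ⬝ᵥ v = 0 := by
      rw [star_quatJ_dotProduct, ← hv, dotProduct_sub, star_quatJ_dotProduct_mulVec hJ,
        star_quatJ_dotProduct_self, sub_zero, neg_zero]
    have hB'v : B' *ᵥ v = v := by
      rw [hB'def, ← mulVec_mulVec, pseudoRotation_mulVec_of_orthogonal _ hjxv, ← mulVec_mulVec,
        ← hθv, mulVec_mulVec, pseudoRotation_neg_mul hx, one_mulVec]
    obtain ⟨hsub, hna, hlt⟩ := positions_descent hB hB' hfix hl hxW hxa hB'v hxv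
    obtain ⟨s, hs, L, hL, hprod⟩ := ih _ hlt hB' hJ' rfl
    refine ⟨a :: s, List.pairwise_cons.mpr ⟨fun b hb => ?_, hs⟩, (θ, x) :: L,
      List.Forall₂.cons ⟨hx, hxa, hθ⟩ hL, ?_⟩
    · have hb' : 2 * b - 1 ∈ positions (movedSpace B') := by
        rw [hprod, positions_movedSpace_skew hL hs]
        exact mem_doubled.mpr ⟨b, hb, Or.inl rfl⟩
      have hle := hl.2 (hsub hb')
      have hne : 2 * a - 1 ≠ 2 * b - 1 := fun h => hna (h ▸ hb')
      omega
    · rw [rotProd_quatJList_cons_reverse, rotProd_cons, Matrix.mul_assoc,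
        ← Matrix.mul_assoc (rotProd L), ← hprod, hB'def,
        Matrix.mul_assoc, pseudoRotation_neg_mul hjx, Matrix.mul_one, ← Matrix.mul_assoc,
        pseudoRotation_mul_neg hx, Matrix.one_mul]

/-! ### Symbols in terms of lists of factors -/

theorem exists_forall_get_iff {α β : Type*} (R : α → β → Prop) (Q : List α → Prop) (s : List β) :
    (∃ f : Fin s.length → α, (∀ j, R (f j) (s.get j)) ∧ Q (List.ofFn f)) ↔
      ∃ L, List.Forall₂ R L s ∧ Q L := by
  constructor
  · rintro ⟨f, hf, hQ⟩
    refine ⟨List.ofFn f, List.forall₂_iff_get.mpr ⟨by simp, fun i h h' => ?_⟩, hQ⟩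
    simpa using hf ⟨i, h'⟩
  · rintro ⟨L, hL, hQ⟩
    obtain ⟨hlen, h⟩ := List.forall₂_iff_get.mp hL
    have hofFn : (List.ofFn fun j : Fin s.length => L.get (j.cast hlen.symm)) = L := by
      refine List.ext_get (by simp [hlen]) fun i _ _ => by simp
    exact ⟨fun j => L.get (j.cast hlen.symm), fun j => h j _ j.isLt, by rwa [hofFn]⟩

theorem angle_iff (θ : ℝ) :
    (∀ z : ℤ, θ ≠ z * (2 * Real.pi)) ↔ Complex.exp (θ * Complex.I) ≠ 1 := by
  rw [Ne, exp_mul_I_eq_one_iff, not_exists]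

theorem hasFullSymbol_iff {B : Matrix (Fin N) (Fin N) ℂ} {s : List ℕ} :
    HasFullSymbol B s ↔
      s.Pairwise (· < ·) ∧ ∃ L, List.Forall₂ Admissible L s ∧ B = rotProd L := by
  rw [HasFullSymbol, ← exists_forall_get_iff]
  refine and_congr_right fun _ => ⟨?_, ?_⟩
  · rintro ⟨θ, x, h, hB⟩
    refine ⟨fun j => (θ j, x j), fun j => ⟨(h j).1, (h j).2.1, (angle_iff _).mp (h j).2.2⟩, ?_⟩
    rw [hB, rotProd, List.map_ofFn]
    rfl
  · rintro ⟨f, h, hB⟩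
    refine ⟨fun j => (f j).1, fun j => (f j).2,
      fun j => ⟨(h j).1, (h j).2.1, (angle_iff _).mpr (h j).2.2⟩, ?_⟩
    rw [hB, rotProd, List.map_ofFn]
    rfl

theorem hasFullSkewSymbol_iff {B : Matrix (Fin (2 * n)) (Fin (2 * n)) ℂ} {s : List ℕ} :
    HasFullSkewSymbol B s ↔
      s.Pairwise (· < ·) ∧ ∃ L, List.Forall₂ Admissible L (s.map fun a => 2 * a - 1) ∧
        B = rotProd L * rotProd (quatJList L).reverse := by
  simp_rw [List.forall₂_map_right_iff]
  rw [HasFullSkewSymbol, ← exists_forall_get_iff]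
  refine and_congr_right fun _ => ⟨?_, ?_⟩
  · rintro ⟨θ, x, h, hB⟩
    refine ⟨fun j => (θ j, x j), fun j => ⟨(h j).1, (h j).2.1, (angle_iff _).mp (h j).2.2⟩, ?_⟩
    rw [hB, rotProd, rotProd, quatJList, List.map_reverse, List.map_ofFn, List.map_ofFn,
      List.map_ofFn]
    rfl
  · rintro ⟨f, h, hB⟩
    refine ⟨fun j => (f j).1, fun j => (f j).2,
      fun j => ⟨(h j).1, (h j).2.1, (angle_iff _).mpr (h j).2.2⟩, ?_⟩
    rw [hB, rotProd, rotProd, quatJList, List.map_reverse, List.map_ofFn, List.map_ofFn,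
      List.map_ofFn]
    rfl

/-- The condition on a factor `(t, x)` at the entry `a` of a symbol in the convention for
`SU_{2n} / Sp_n`; the angle of the factor is `2πt`. -/
def NormalizedAt (q : ℝ × (Fin N → ℂ)) (a : ℕ) : Prop :=
  0 < q.1 ∧ q.1 < 1 ∧ IsUnitVector q.2 ∧ MinMem q.2 a ∧ PosCoord q.2 a

/-- Replaces each `(t, x)` by `(2πt, x)`. -/
noncomputable def toAngles (L : List (ℝ × (Fin N → ℂ))) : List (ℝ × (Fin N → ℂ)) :=
  L.map fun q => (2 * Real.pi * q.1, q.2)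

theorem hasReducedSkewSymbol_iff {B : Matrix (Fin (2 * n)) (Fin (2 * n)) ℂ} {s : List ℕ} :
    HasReducedSkewSymbol B s ↔
      s.Pairwise (· < ·) ∧ (∀ a ∈ s, 1 < a) ∧
        ∃ L, List.Forall₂ NormalizedAt L (s.map fun a => 2 * a - 1) ∧
          B = pseudoRotation (-(2 * Real.pi * (L.map Prod.fst).sum)) (e₁ (2 * n)) *
            rotProd (toAngles L) * rotProd (quatJList (toAngles L)).reverse *
            pseudoRotation (-(2 * Real.pi * (L.map Prod.fst).sum)) (quatJ (e₁ (2 * n))) := by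
  simp_rw [List.forall₂_map_right_iff]
  rw [HasReducedSkewSymbol, ← exists_forall_get_iff]
  refine and_congr_right fun _ => and_congr_right fun _ => ⟨?_, ?_⟩
  · rintro ⟨t, x, h, hB⟩
    refine ⟨fun j => (t j, x j), h, ?_⟩
    rw [hB, rotProd, rotProd, quatJList, toAngles, List.map_reverse, List.map_ofFn, List.map_ofFn,
      List.map_ofFn, List.map_ofFn, List.map_ofFn, List.sum_ofFn]
    rfl
  · rintro ⟨f, h, hB⟩
    refine ⟨fun j => (f j).1, fun j => (f j).2, h, ?_⟩
    rw [hB, rotProd, rotProd, quatJList, toAngles, List.map_reverse, List.map_ofFn, List.map_ofFn,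
      List.map_ofFn, List.map_ofFn, List.map_ofFn, List.sum_ofFn]
    rfl

/-! ### The sum of the angles over the orbit of `SU_{2n}` -/

theorem det_eq_one_of_mul_Jmat_mul_transpose {M : Matrix (Fin (2 * n)) (Fin (2 * n)) ℂ}
    (hM : M * Jmat n * Mᵀ = Jmat n) : M.det = 1 := by
  -- Mathlib's symplectic form is `!![0, -1; 1, 0]` on the sum of two copies of the index type.
  let f : Fin n ⊕ Fin n → Fin (2 * n) :=
    Sum.elim (fun i => ⟨2 * i + 1, by omega⟩) (fun i => ⟨2 * i, by omega⟩)
  have hf : Function.Bijective f := by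
    refine (Fintype.bijective_iff_injective_and_card f).mpr ⟨?_, by simp; omega⟩
    rintro (i | i) (j | j) h <;> simp only [f, Sum.elim_inl, Sum.elim_inr, Fin.mk.injEq] at h
    · exact congrArg Sum.inl (Fin.ext (by omega))
    · omega
    · omega
    · exact congrArg Sum.inr (Fin.ext (by omega))
  let e := Equiv.ofBijective f hf
  have hJ : (Jmat n).submatrix e e = J (Fin n) ℂ := by
    ext (i | i) (j | j)
    · have h1 : ¬ (2 * (i : ℕ) + 1) % 2 = 0 := by omega
      have h2 : ¬ (2 * (j : ℕ) + 1) % 2 = 0 := by omega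
      simp only [e, f, Jmat, J, submatrix_apply, Equiv.ofBijective_apply, Sum.elim_inl, of_apply,
        fromBlocks_apply₁₁, Matrix.zero_apply, h1, h2, false_and, if_false]
    · by_cases h : i = j
      · simp [e, f, Jmat, J, h]
      · have h' : ¬ (i : ℕ) = j := fun hh => h (Fin.ext hh)
        simp [e, f, Jmat, J, h, h']
    · by_cases h : i = j
      · simp [e, f, Jmat, J, h]
      · have h' : ¬ (j : ℕ) = i := fun hh => h (Fin.ext hh.symm)
        simp [e, f, Jmat, J, h, h']
    · have h1 : ¬ (2 * (j : ℕ)) = 2 * (i : ℕ) + 1 := by omega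
      have h2 : ¬ (2 * (i : ℕ)) = 2 * (j : ℕ) + 1 := by omega
      simp [e, f, Jmat, J, h1, h2]
  rw [← det_submatrix_equiv_self e]
  refine SymplecticGroup.det_eq_one (SymplecticGroup.mem_iff.mpr ?_)
  rw [← hJ, transpose_submatrix, submatrix_mul_equiv, submatrix_mul_equiv, hM]

theorem Jmat_mul_rotProd_transpose (L : List (ℝ × (Fin (2 * n) → ℂ))) :
    Jmat n * (rotProd L)ᵀ = rotProd (quatJList L).reverse * Jmat n := by
  induction L with
  | nil => simp [quatJList]
  | cons q L ih =>
    rw [rotProd_quatJList_cons_reverse, rotProd_cons, transpose_mul, ← Matrix.mul_assoc, ih,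
      Matrix.mul_assoc,
      Jmat_mul_pseudoRotation_transpose, Matrix.mul_assoc]

theorem det_rotProd {L : List (ℝ × (Fin N → ℂ))} (h : ∀ q ∈ L, IsUnitVector q.2) :
    (rotProd L).det = Complex.exp ((L.map Prod.fst).sum * Complex.I) := by
  induction L with
  | nil => simp
  | cons q L ih =>
    rw [rotProd_cons, det_mul, det_pseudoRotation (h q List.mem_cons_self),
      ih fun q hq => h q (List.mem_cons_of_mem _ hq), List.map_cons, List.sum_cons,
      Complex.ofReal_add, add_mul, Complex.exp_add]

/-- For `B = C J_n Cᵀ J_n^*` the determinant of the left half `P` of a skew-symmetric factorization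
is `1`: since `P J_n Pᵀ = C J_n Cᵀ`, the matrix `C⁻¹ P` is symplectic. -/
theorem exp_sum_eq_one_of_mem_cartanOrbitSk {L : List (ℝ × (Fin (2 * n) → ℂ))}
    (hL : ∀ q ∈ L, IsUnitVector q.2)
    (hB : rotProd L * rotProd (quatJList L).reverse ∈ cartanOrbitSk n) :
    Complex.exp ((L.map Prod.fst).sum * Complex.I) = 1 := by
  obtain ⟨C, hC, hB⟩ := hB
  obtain ⟨hCu, hCdet⟩ := mem_specialUnitaryGroup_iff.mp hC
  have hCC : Cᴴ * C = 1 := by rw [← star_eq_conjTranspose, mem_unitaryGroup_iff'.mp hCu]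
  have hP : rotProd L * Jmat n * (rotProd L)ᵀ = C * Jmat n * Cᵀ := by
    rw [Matrix.mul_assoc, Jmat_mul_rotProd_transpose, ← Matrix.mul_assoc, hB, Jmat_conjTranspose,
      Matrix.mul_assoc, neg_mul, Jmat_mul_Jmat, neg_neg, Matrix.mul_one]
  have hM : (Cᴴ * rotProd L) * Jmat n * (Cᴴ * rotProd L)ᵀ = Jmat n := by
    calc (Cᴴ * rotProd L) * Jmat n * (Cᴴ * rotProd L)ᵀ
        = Cᴴ * (rotProd L * Jmat n * (rotProd L)ᵀ) * Cᴴᵀ := by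
          rw [transpose_mul]
          simp only [Matrix.mul_assoc]
      _ = (Cᴴ * C) * Jmat n * (Cᴴ * C)ᵀ := by
          rw [hP, transpose_mul]
          simp only [Matrix.mul_assoc]
      _ = Jmat n := by rw [hCC, transpose_one, Matrix.one_mul, Matrix.mul_one]
  have hdet := det_eq_one_of_mul_Jmat_mul_transpose hM
  rwa [det_mul, det_conjTranspose, hCdet, star_one, one_mul, det_rotProd hL] at hdet

/-! ### Normalization of factors -/

theorem exists_normalizedAt {q : ℝ × (Fin N → ℂ)} {a : ℕ} (h : Admissible q a) :
    ∃ q' : ℝ × (Fin N → ℂ), NormalizedAt q' a ∧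
      Complex.exp ((2 * Real.pi * q'.1 : ℝ) * Complex.I) = Complex.exp (q.1 * Complex.I) ∧
      ∃ u : ℂ, ‖u‖ = 1 ∧ q.2 = u • q'.2 := by
  obtain ⟨hx, hxa, hθ⟩ := h
  obtain ⟨i, hi, hxi⟩ := hxa.1
  have hr : ((‖q.2 i‖ : ℝ) : ℂ) ≠ 0 := Complex.ofReal_ne_zero.mpr (norm_ne_zero_iff.mpr hxi)
  set u : ℂ := q.2 i / ‖q.2 i‖ with hu
  have hu1 : ‖u‖ = 1 := by simp [hu, hxi]
  have hu0 : u ≠ 0 := by simp [hu, hxi]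
  have hui : (u⁻¹ • q.2) i = ‖q.2 i‖ := by
    simp only [Pi.smul_apply, smul_eq_mul, hu]
    field_simp
  set t := Int.fract (q.1 / (2 * Real.pi)) with ht
  have hexp : Complex.exp ((2 * Real.pi * t : ℝ) * Complex.I)
      = Complex.exp (q.1 * Complex.I) := by
    refine Complex.exp_eq_exp_iff_exists_int.mpr ⟨-⌊q.1 / (2 * Real.pi)⌋, ?_⟩
    have h : 2 * Real.pi * t = q.1 - ⌊q.1 / (2 * Real.pi)⌋ * (2 * Real.pi) := by
      rw [ht, Int.fract]
      field_simp
    rw [h]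
    push_cast
    ring
  have ht0 : t ≠ 0 := by
    intro h
    rw [h] at hexp
    exact hθ (by simpa using hexp.symm)
  refine ⟨(t, u⁻¹ • q.2), ⟨lt_of_le_of_ne (Int.fract_nonneg _) ht0.symm, Int.fract_lt_one _, ?_,
    hxa.smul (inv_ne_zero hu0), i, hi, ?_, ?_⟩, hexp, u, hu1, ?_⟩
  · simpa [IsUnitVector, norm_smul, hu1] using hx
  · change 0 < ((u⁻¹ • q.2) i).re
    rw [hui, Complex.ofReal_re]
    exact norm_pos_iff.mpr hxi
  · change ((u⁻¹ • q.2) i).im = 0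
    rw [hui, Complex.ofReal_im]
  · rw [smul_smul, mul_inv_cancel₀ hu0, one_smul]

theorem pseudoRotation_quatJ_smul (θ : ℝ) (x : Fin (2 * n) → ℂ) {u : ℂ} (hu : ‖u‖ = 1) :
    pseudoRotation θ (quatJ (u • x)) = pseudoRotation θ (quatJ x) := by
  rw [quatJ_smul, pseudoRotation_smul _ _ (by rwa [norm_star])]

theorem exists_normalized {L : List (ℝ × (Fin (2 * n) → ℂ))} {p : List ℕ}
    (h : List.Forall₂ Admissible L p) :
    ∃ L', List.Forall₂ NormalizedAt L' p ∧ rotProd (toAngles L') = rotProd L ∧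
      rotProd (quatJList (toAngles L')).reverse = rotProd (quatJList L).reverse ∧
      Complex.exp ((2 * Real.pi * (L'.map Prod.fst).sum : ℝ) * Complex.I)
        = Complex.exp ((L.map Prod.fst).sum * Complex.I) := by
  induction h with
  | nil => exact ⟨[], List.Forall₂.nil, by simp [toAngles, quatJList]⟩
  | @cons q a L p hq _ ih =>
    obtain ⟨L', hL', h1, h2, h3⟩ := ih
    obtain ⟨q', hq', hexp, u, hu, hqu⟩ := exists_normalizedAt hq
    refine ⟨q' :: L', List.Forall₂.cons hq' hL', ?_, ?_, ?_⟩
    · rw [rotProd_cons, ← h1, hqu, pseudoRotation_smul _ _ hu, ← pseudoRotation_congr _ hexp]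
      simp [toAngles]
    · rw [rotProd_quatJList_cons_reverse, ← h2, hqu, pseudoRotation_quatJ_smul _ _ hu,
        ← pseudoRotation_congr _ hexp]
      simp [toAngles, quatJList]
    · simp only [List.map_cons, List.sum_cons, mul_add, Complex.ofReal_add, add_mul,
        Complex.exp_add]
      rw [hexp, h3]

theorem NormalizedAt.admissible {q : ℝ × (Fin N → ℂ)} {a : ℕ} (h : NormalizedAt q a) :
    Admissible (2 * Real.pi * q.1, q.2) a := by
  obtain ⟨h0, h1, hx, hxa, -⟩ := h
  refine ⟨hx, hxa, (angle_iff _).mp fun z hz => ?_⟩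
  have hq : q.1 = z := by
    have := Real.pi_pos
    have : 2 * Real.pi * (q.1 - z) = 0 := by linear_combination hz
    rcases mul_eq_zero.mp this with h | h
    · linarith
    · linarith
  rw [hq] at h0 h1
  have h0 : 0 < z := by exact_mod_cast h0
  have h1 : z < 1 := by exact_mod_cast h1
  omega

theorem forall₂_toAngles {L : List (ℝ × (Fin N → ℂ))} {p : List ℕ}
    (h : List.Forall₂ NormalizedAt L p) : List.Forall₂ Admissible (toAngles L) p := by
  rw [toAngles, List.forall₂_map_left_iff]
  exact h.imp fun _ _ h => h.admissible

theorem isUnitVector_e₁ (hN : 0 < N) : IsUnitVector (e₁ N) := by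
  rw [IsUnitVector, Finset.sum_eq_single ⟨0, hN⟩]
  · simp [e₁]
  · intro i _ hi
    have : (i : ℕ) ≠ 0 := fun h => hi (Fin.ext h)
    simp [e₁, this]
  · simp

theorem minMem_e₁ (hN : 0 < N) : MinMem (e₁ N) 1 :=
  ⟨⟨⟨0, hN⟩, rfl, by simp [e₁]⟩, fun i hi => by
    have : (i : ℕ) ≠ 0 := by omega
    simp [e₁, this]⟩

theorem exists_eq_smul_e₁ {x : Fin N → ℂ} (hx : IsUnitVector x) (h : MinMem x 1) :
    ∃ u : ℂ, ‖u‖ = 1 ∧ x = u • e₁ N := by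
  obtain ⟨⟨i, hi, -⟩, h0⟩ := h
  have hxe : x = x i • e₁ N := by
    ext j
    by_cases hj : (j : ℕ) = 0
    · rw [show j = i from Fin.ext (by omega)]
      simp [e₁, show (i : ℕ) = 0 by omega]
    · simp [e₁, hj, h0 j (by omega)]
  refine ⟨x i, ?_, hxe⟩
  have h1 := hx
  have he := isUnitVector_e₁ (N := N) (by omega)
  rw [hxe] at h1
  simp only [IsUnitVector, Pi.smul_apply, norm_smul, mul_pow, ← Finset.mul_sum] at h1 he
  rw [he, mul_one] at h1
  exact (pow_eq_one_iff_of_nonneg (norm_nonneg _) two_ne_zero).mp h1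

/-! ### Uniqueness of the symbols -/

theorem eq_of_doubled_eq {s m : List ℕ} (hs : s.Pairwise (· < ·)) (hm : m.Pairwise (· < ·))
    (hs1 : ∀ a ∈ s, 1 ≤ a) (hm1 : ∀ a ∈ m, 1 ≤ a) (h : ∀ b, b ∈ doubled s ↔ b ∈ doubled m) :
    s = m := by
  refine hs.eq_of_mem_iff hm fun a => ?_
  have key : ∀ l : List ℕ, (∀ a ∈ l, 1 ≤ a) → (a ∈ l ↔ 2 * a ∈ doubled l) := fun l hl => by
    rw [mem_doubled]
    refine ⟨fun ha => ⟨a, ha, Or.inr rfl⟩, ?_⟩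
    rintro ⟨b, hb, hab⟩
    have := hl b hb
    rwa [show a = b by omega]
  rw [key s hs1, key m hm1, h]

theorem eq_cons_of_mem_one {m : List ℕ} (hm : m.Pairwise (· < ·)) (hm1 : ∀ a ∈ m, 1 ≤ a)
    (h : 1 ∈ m) : m = 1 :: m.erase 1 := by
  cases m with
  | nil => simp at h
  | cons a m =>
    have ha := hm1 a List.mem_cons_self
    rcases List.mem_cons.mp h with rfl | h
    · rw [List.erase_cons_head]
    · have := (List.pairwise_cons.mp hm).1 1 h
      omega

theorem hasReducedSymbol_iff {B : Matrix (Fin N) (Fin N) ℂ} {D : List ℕ}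
    (hD : D.Pairwise (· < ·)) (hD1 : ∀ a ∈ D, 1 ≤ a) (h : ∀ s, HasFullSymbol B s ↔ s = D)
    (s : List ℕ) : HasReducedSymbol B s ↔ s = D.erase 1 := by
  rw [HasReducedSymbol, h, h]
  by_cases h1 : 1 ∈ D
  · have hcons := eq_cons_of_mem_one hD hD1 h1
    constructor
    · rintro (⟨rfl, hs⟩ | hs)
      · exact absurd h1 hs
      · rw [← hs, List.erase_cons_head]
    · rintro rfl
      exact Or.inr hcons.symm
  · rw [List.erase_of_not_mem h1]
    constructor
    · rintro (⟨rfl, -⟩ | rfl)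
      · rfl
      · simp at h1
    · rintro rfl
      exact Or.inl ⟨rfl, h1⟩

theorem HasReducedSkewSymbol.hasFullSkewSymbol {B : Matrix (Fin (2 * n)) (Fin (2 * n)) ℂ}
    {s : List ℕ} (h : HasReducedSkewSymbol B s) :
    HasFullSkewSymbol B s ∨ HasFullSkewSymbol B (1 :: s) := by
  obtain ⟨hs, hs1, L, hL, hB⟩ := hasReducedSkewSymbol_iff.mp h
  simp only [hasFullSkewSymbol_iff]
  set φ := -(2 * Real.pi * (L.map Prod.fst).sum) with hφ
  by_cases hexp : Complex.exp (φ * Complex.I) = 1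
  · refine Or.inl ⟨hs, toAngles L, forall₂_toAngles hL, ?_⟩
    rw [hB, pseudoRotation_eq_one _ hexp, pseudoRotation_eq_one _ hexp, Matrix.one_mul,
      Matrix.mul_one]
  · right
    -- The angle `φ` is nonzero, so there is some factor, and `e₁` really is a unit vector.
    have hn : 0 < 2 * n := by
      revert hL
      generalize s.map (fun a => 2 * a - 1) = p
      rintro (_ | ⟨hq, -⟩)
      · simp [hφ] at hexp
      · exact hq.2.2.2.1.pos.trans hq.2.2.2.1.le
    refine ⟨List.pairwise_cons.mpr ⟨hs1, hs⟩, (φ, e₁ (2 * n)) :: toAngles L,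
      List.Forall₂.cons ⟨isUnitVector_e₁ hn, minMem_e₁ hn, hexp⟩ (forall₂_toAngles hL), ?_⟩
    rw [hB, rotProd_quatJList_cons_reverse, rotProd_cons]
    simp only [Matrix.mul_assoc]

theorem HasFullSkewSymbol.hasReducedSkewSymbol {B : Matrix (Fin (2 * n)) (Fin (2 * n)) ℂ}
    {m : List ℕ} (h : HasFullSkewSymbol B m) (hB : B ∈ cartanOrbitSk n) :
    HasReducedSkewSymbol B (m.erase 1) := by
  obtain ⟨hm, L, hL, rfl⟩ := hasFullSkewSymbol_iff.mp h
  have hm1 := one_le_of_forall₂ hL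
  have hsum := exp_sum_eq_one_of_mem_cartanOrbitSk (isUnitVector_of_forall₂ hL) hB
  have hlt : ∀ a ∈ m.erase 1, 1 < a := fun a ha => by
    obtain ⟨hne, ha⟩ := (hm.nodup.mem_erase_iff).mp ha
    have := hm1 a ha
    omega
  refine hasReducedSkewSymbol_iff.mpr ⟨hm.sublist List.erase_sublist, hlt, ?_⟩
  by_cases h1 : 1 ∈ m
  · rw [eq_cons_of_mem_one hm hm1 h1, List.map_cons] at hL
    cases hL with
    | @cons q _ L _ hq hL =>
    obtain ⟨L', hL', hP, hQ, hexp⟩ := exists_normalized hL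
    obtain ⟨u, hu, hqu⟩ := exists_eq_smul_e₁ hq.1 hq.2.1
    refine ⟨L', hL', ?_⟩
    have hφ : Complex.exp ((-(2 * Real.pi * (L'.map Prod.fst).sum) : ℝ) * Complex.I)
        = Complex.exp (q.1 * Complex.I) := by
      rw [List.map_cons, List.sum_cons, Complex.ofReal_add, add_mul, Complex.exp_add, ← hexp]
        at hsum
      rw [Complex.ofReal_neg, neg_mul, Complex.exp_neg]
      exact (eq_inv_of_mul_eq_one_left hsum).symm
    rw [rotProd_quatJList_cons_reverse, rotProd_cons, hP, hQ, pseudoRotation_congr _ hφ,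
      pseudoRotation_congr _ hφ, hqu,
      pseudoRotation_smul _ _ hu, pseudoRotation_quatJ_smul _ _ hu]
    simp only [Matrix.mul_assoc]
  · obtain ⟨L', hL', hP, hQ, hexp⟩ := exists_normalized hL
    rw [List.erase_of_not_mem h1]
    refine ⟨L', hL', ?_⟩
    have hφ : Complex.exp ((-(2 * Real.pi * (L'.map Prod.fst).sum) : ℝ) * Complex.I) = 1 := by
      rw [Complex.ofReal_neg, neg_mul, Complex.exp_neg, hexp, hsum, inv_one]
    rw [pseudoRotation_eq_one _ hφ, pseudoRotation_eq_one _ hφ, hP, hQ, Matrix.one_mul,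
      Matrix.mul_one]

end SkewSchubert

open SkewSchubert in
theorem corollary5p10 (n : ℕ) (B : Matrix (Fin (2 * n)) (Fin (2 * n)) ℂ)
    (hB : B ∈ cartanModelSk n) :
    ∃ m : List ℕ, m.Pairwise (· < ·) ∧ (∀ a ∈ m, 1 ≤ a ∧ a ≤ n) ∧
      (∀ s : List ℕ, HasFullSymbol B s ↔ s = doubled m) ∧
      (∀ s : List ℕ, HasFullSkewSymbol B s ↔ s = m) ∧
      (∀ s : List ℕ, HasReducedSymbol B s ↔ s = (doubled m).erase 1) ∧
      (B ∈ cartanOrbitSk n → ∀ s : List ℕ, HasReducedSkewSymbol B s ↔ s = m.erase 1) := by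
  obtain ⟨hBu, hJ⟩ := mem_cartanModelSk hB
  obtain ⟨m, hm, L, hL, hprod⟩ := exists_rotProd_skew hBu hJ
  have hm1 := one_le_of_forall₂ hL
  have hpos : positions (movedSpace B) = {b | b ∈ doubled m} := by
    rw [hprod, positions_movedSpace_skew hL hm]
  have hD := pairwise_doubled hm hm1
  have hD1 : ∀ b ∈ doubled m, 1 ≤ b := fun b hb => by
    obtain ⟨a, ha, hab⟩ := mem_doubled.mp hb
    have := hm1 a ha
    omega
  have hfull_eq : ∀ s, HasFullSymbol B s → s = doubled m := fun s h => by
    obtain ⟨hs, L', hL', hprod'⟩ := hasFullSymbol_iff.mp h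
    have hpos' := positions_movedSpace_rotProd hL' hs.nodup
    rw [← hprod', hpos] at hpos'
    exact hs.eq_of_mem_iff hD fun b => (Set.ext_iff.mp hpos' b).symm
  have hfull : ∀ s, HasFullSymbol B s ↔ s = doubled m := fun s => by
    refine ⟨hfull_eq s, ?_⟩
    rintro rfl
    obtain ⟨s, hs⟩ := exists_rotProd hBu
    have hs := hasFullSymbol_iff.mpr hs
    exact hfull_eq s hs ▸ hs
  have hskew : ∀ s, HasFullSkewSymbol B s ↔ s = m := fun s => by
    refine ⟨fun h => ?_, ?_⟩
    · obtain ⟨hs, L', hL', hprod'⟩ := hasFullSkewSymbol_iff.mp h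
      have hpos' := positions_movedSpace_skew hL' hs
      rw [← hprod', hpos] at hpos'
      exact eq_of_doubled_eq hs hm (one_le_of_forall₂ hL') hm1
        fun b => (Set.ext_iff.mp hpos' b).symm
    · rintro rfl
      exact hasFullSkewSymbol_iff.mpr ⟨hm, L, hL, hprod⟩
  refine ⟨m, hm, fun a ha => ⟨hm1 a ha, ?_⟩, hfull, hskew, hasReducedSymbol_iff hD hD1 hfull,
    fun horbit s => ⟨fun h => ?_, ?_⟩⟩
  · obtain ⟨q, -, hq⟩ := exists_of_mem_right hL (List.mem_map_of_mem ha)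
    have := hq.2.1.le
    omega
  · have h1 : 1 ∉ s := fun h1 => lt_irrefl 1 (h.2.1 1 h1)
    rcases h.hasFullSkewSymbol with h | h
    · rw [← (hskew s).mp h, List.erase_of_not_mem h1]
    · rw [← (hskew _).mp h, List.erase_cons_head]
  · rintro rfl
    exact ((hskew m).mpr rfl).hasReducedSkewSymbol horbit
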